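/- Let $p,q\ge 1$ be integers, $d=p+q$, and let $C(\mathbb{R}^d)$ be the real vector space of continuous functions $\mathbb{R}^d\to\mathbb{R}$. Let $\mathbf{O}(p,q)$ be the group of real $d\times d$ matrices $A$ with $A^T I_{p,q}A=I_{p,q}$, where $I_{p,q}=\begin{pmatrix} I_p & 0\\ 0& -I_q\end{pmatrix}$. Let $V\subset C(\mathbb{R}^d)$ be a finite-dimensional vector subspace such that, for every $g\in V$, the function $x\mapsto g(x+h)$ belongs to $V$ for all $h\in\mathbb{R}^d$, and the function $x\mapsto g(Ax)$ belongs to $V$ for all $A\in\mathbf{O}(p,q)$. Then every $f\in V$ is an ordinary polynomial in $d$ real variables, i.e. there is $F\in\mathbb{R}[x_1,\dots,x_d]$ with $f(x)=F(x)$ for all $x\in\mathbb{R}^d$. -/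

import Mathlib

open scoped Matrix

/-- The operator `τ_h` on `C(ℝ^ι)`: `(τ_h g)(x) = g (x + h)`. -/
def translateOp {ι : Type*} (h : ι → ℝ) (g : C(ι → ℝ, ℝ)) : C(ι → ℝ, ℝ) where
  toFun x := g (x + h)
  continuous_toFun := by fun_prop

/-- The operator `O_P` on `C(ℝ^ι)`, for an invertible matrix `P`: `(O_P g)(x) = g (P x)`. -/
def linearOp {ι : Type*} [Fintype ι] [DecidableEq ι] (P : GL ι ℝ) (g : C(ι → ℝ, ℝ)) :
    C(ι → ℝ, ℝ) where
  toFun x := g ((P : Matrix ι ι ℝ) *ᵥ x)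
  continuous_toFun := g.continuous.comp (continuous_const.matrix_mulVec continuous_id)

/-- A subspace `V` of `C(ℝ^ι)` is translation invariant if `τ_h(V) ⊆ V` for every `h`. -/
def IsTranslationInvariant {ι : Type*} (V : Submodule ℝ C(ι → ℝ, ℝ)) : Prop :=
  ∀ h : ι → ℝ, ∀ g ∈ V, translateOp h g ∈ V

/-- A subspace `V` of `C(ℝ^ι)` is invariant by elements of a subgroup `G` of the general linear
group if `O_P(V) ⊆ V` for every `P ∈ G`. -/
def IsInvariantBy {ι : Type*} [Fintype ι] [DecidableEq ι] (G : Subgroup (GL ι ℝ))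
    (V : Submodule ℝ C(ι → ℝ, ℝ)) : Prop :=
  ∀ P ∈ G, ∀ g ∈ V, linearOp P g ∈ V

/-- `f` is an ordinary polynomial in the real variables indexed by `ι`. -/
def IsOrdinaryPolynomial {ι : Type*} (f : C(ι → ℝ, ℝ)) : Prop :=
  ∃ F : MvPolynomial ι ℝ, ∀ x : ι → ℝ, f x = MvPolynomial.eval x F

/-- The matrix `I_{p,q}`, with diagonal blocks `I_p` and `-I_q` and zero blocks elsewhere. -/
def signatureMatrix (p q : ℕ) : Matrix (Fin p ⊕ Fin q) (Fin p ⊕ Fin q) ℝ :=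
  Matrix.fromBlocks 1 0 0 (-1)

/-- The group `O(p,q)` of the invertible real matrices `A` with `Aᵀ I_{p,q} A = I_{p,q}`. -/
def indefiniteOrthogonalGroup (p q : ℕ) : Subgroup (GL (Fin p ⊕ Fin q) ℝ) where
  carrier := {A | (A : Matrix (Fin p ⊕ Fin q) (Fin p ⊕ Fin q) ℝ)ᵀ * signatureMatrix p q *
    (A : Matrix (Fin p ⊕ Fin q) (Fin p ⊕ Fin q) ℝ) = signatureMatrix p q}
  one_mem' := by simp
  mul_mem' := by
    intro A B hA hB
    simp only [Set.mem_ofPred_eq, Units.val_mul, Matrix.transpose_mul] at hA hB ⊢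
    calc _ = (B : Matrix (Fin p ⊕ Fin q) (Fin p ⊕ Fin q) ℝ)ᵀ *
          ((A : Matrix (Fin p ⊕ Fin q) (Fin p ⊕ Fin q) ℝ)ᵀ * signatureMatrix p q * A) * B := by
            simp only [Matrix.mul_assoc]
      _ = _ := by rw [hA, hB]
  inv_mem' := by
    intro A hA
    simp only [Set.mem_ofPred_eq] at hA ⊢
    have h1 : (A : Matrix (Fin p ⊕ Fin q) (Fin p ⊕ Fin q) ℝ) *
        ((A⁻¹ : GL (Fin p ⊕ Fin q) ℝ) : Matrix (Fin p ⊕ Fin q) (Fin p ⊕ Fin q) ℝ) = 1 :=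
      A.mul_inv
    have h2 : ((A⁻¹ : GL (Fin p ⊕ Fin q) ℝ) : Matrix (Fin p ⊕ Fin q) (Fin p ⊕ Fin q) ℝ)ᵀ *
        (A : Matrix (Fin p ⊕ Fin q) (Fin p ⊕ Fin q) ℝ)ᵀ = 1 := by
      rw [← Matrix.transpose_mul, h1, Matrix.transpose_one]
    generalize ((A⁻¹ : GL (Fin p ⊕ Fin q) ℝ) : Matrix (Fin p ⊕ Fin q) (Fin p ⊕ Fin q) ℝ) = B at *
    calc Bᵀ * signatureMatrix p q * B
        = Bᵀ * ((A : Matrix (Fin p ⊕ Fin q) (Fin p ⊕ Fin q) ℝ)ᵀ * signatureMatrix p q * A) * B := by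
          rw [hA]
      _ = (Bᵀ * (A : Matrix (Fin p ⊕ Fin q) (Fin p ⊕ Fin q) ℝ)ᵀ) * signatureMatrix p q *
            ((A : Matrix (Fin p ⊕ Fin q) (Fin p ⊕ Fin q) ℝ) * B) := by
          simp only [Matrix.mul_assoc]
      _ = signatureMatrix p q := by rw [h1, h2, Matrix.one_mul, Matrix.mul_one]

/-!
The idea is that translations along null directions must act unipotently on `V`. If `u` is a null
vector `r (e_i ± e_j)`, with `e_i` in the positive and `e_j` in the negative block, hyperbolic
rotations in the plane of `e_i` and `e_j` scale `u` by every positive integer `n`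
(`exists_mulVec_null_eq_smul`). As `O_P` conjugates the translation by `P u = n u` into the
translation by `u`, the operator `τ_u` on the finite-dimensional space `V` is conjugate to all its
powers `τ_u ^ n`. Its complex spectrum is then a finite set of nonzero numbers which every power
map sends onto itself: the eigenvalues are roots of unity, and a power killing all of them shows
that the spectrum is `{1}` (`Module.End.isNilpotent_sub_one_of_pow_conj`).

Every multiple of a coordinate vector is a sum of two null vectors of this kind, and translations
commute, so the translations along the coordinate axes are unipotent. Hence differences of order
`dim V` in these directions vanish on `V`. A continuous function of one variable all of whose
`M`-th differences vanish equals its Newton polynomial, first at rational and then at all points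
(`eq_eval_newtonPoly`). The Newton coefficients are iterated differences, which lie in `V` again,
so one coordinate can be expanded after another (`isOrdinaryPolynomial_of_isNilpotent`).
-/

/-! ### Operators conjugate to their powers -/

/-- If every positive power of a complex matrix `A` is conjugate to `A`, then its spectrum is a
finite set of nonzero numbers stable under all power maps `z ↦ z ^ n` (with each of these maps
onto), hence consists of `1` alone. -/
theorem Matrix.isNilpotent_sub_one_of_pow_conj {n : Type*} [Fintype n] [DecidableEq n]
    (A : (Matrix n n ℂ)ˣ)
    (h : ∀ k : ℕ, 1 ≤ k → ∃ U : (Matrix n n ℂ)ˣ,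
      (A : Matrix n n ℂ) ^ k = U * A * (↑U⁻¹ : Matrix n n ℂ)) :
    IsNilpotent ((A : Matrix n n ℂ) - 1) := by
  set S := spectrum ℂ (A : Matrix n n ℂ) with hS
  have hfin : S.Finite := Matrix.finite_spectrum _
  have hpow : ∀ k : ℕ, 1 ≤ k → (fun z : ℂ => z ^ k) '' S = S := by
    intro k hk
    obtain ⟨U, hU⟩ := h k hk
    rw [hS, ← spectrum.map_pow_of_pos _ (by omega), hU, spectrum.units_conjugate]
  have hzero : (0 : ℂ) ∉ S := spectrum.zero_notMem ℂ A.isUnit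
  -- the powers of `z` stay in the finite set `S`, so two of them coincide
  have hord : ∀ z ∈ S, ∃ k : ℕ, 0 < k ∧ z ^ k = 1 := by
    intro z hz
    have hz0 : z ≠ 0 := fun h0 => hzero (h0 ▸ hz)
    have hmaps : Set.MapsTo (fun k : ℕ => z ^ (k + 1)) Set.univ S := fun k _ => by
      rw [← hpow (k + 1) (by omega)]
      exact ⟨z, hz, rfl⟩
    obtain ⟨a, -, b, -, hab, he⟩ :=
      Set.infinite_univ.exists_lt_map_eq_of_mapsTo hmaps hfin
    refine ⟨b - a, by omega, ?_⟩
    have hb : b + 1 = (a + 1) + (b - a) := by omega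
    rw [hb, pow_add z (a + 1)] at he
    exact (mul_eq_left₀ (pow_ne_zero _ hz0)).1 he.symm
  choose! o ho ho' using hord
  have hone : ∀ z ∈ S, z = 1 := by
    intro z hz
    -- the power map for `∏ w, o w` sends all of `S` to `1`, and its image is `S`
    have hN : 1 ≤ ∏ w ∈ hfin.toFinset, o w :=
      Finset.prod_pos fun w hw => ho w (hfin.mem_toFinset.1 hw)
    rw [← hpow _ hN] at hz
    obtain ⟨w, hw, rfl⟩ := hz
    obtain ⟨c, hc⟩ := Finset.dvd_prod_of_mem o (hfin.mem_toFinset.2 hw)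
    simp only [hc, pow_mul, ho' w hw, one_pow]
  have hroots : (A : Matrix n n ℂ).charpoly.roots =
      Multiset.replicate (Multiset.card (A : Matrix n n ℂ).charpoly.roots) 1 := by
    refine Multiset.eq_replicate_card.2 fun z hz => hone z ?_
    exact Matrix.mem_spectrum_iff_isRoot_charpoly.2 (Polynomial.isRoot_of_mem_roots hz)
  have hprod := (IsAlgClosed.splits (A : Matrix n n ℂ).charpoly).eq_prod_roots_of_monic
    (Matrix.charpoly_monic _)
  rw [hroots] at hprod
  refine ⟨Multiset.card (A : Matrix n n ℂ).charpoly.roots, ?_⟩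
  have hCH := Matrix.aeval_self_charpoly (A : Matrix n n ℂ)
  rw [hprod] at hCH
  simpa using hCH

/-- An automorphism of a finite-dimensional real vector space which is conjugate to all its
positive powers is unipotent. -/
theorem Module.End.isNilpotent_sub_one_of_pow_conj {E : Type*} [AddCommGroup E] [Module ℝ E]
    [FiniteDimensional ℝ E] (T : (Module.End ℝ E)ˣ)
    (h : ∀ k : ℕ, 1 ≤ k → ∃ U : (Module.End ℝ E)ˣ,
      (T : Module.End ℝ E) ^ k = U * T * (↑U⁻¹ : Module.End ℝ E)) :
    IsNilpotent ((T : Module.End ℝ E) - 1) := by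
  let b := Module.finBasis ℝ E
  let φ : Module.End ℝ E →+* Matrix (Fin (Module.finrank ℝ E)) (Fin (Module.finrank ℝ E)) ℂ :=
    (Complex.ofRealHom.mapMatrix).comp (LinearMap.toMatrixAlgEquiv b : _ →+* _)
  have hφ : Function.Injective φ := by
    refine Function.Injective.comp (g := Complex.ofRealHom.mapMatrix) ?_
      (LinearMap.toMatrixAlgEquiv b).injective
    exact Matrix.map_injective Complex.ofReal_injective
  rw [← IsNilpotent.map_iff hφ, map_sub, map_one]
  refine Matrix.isNilpotent_sub_one_of_pow_conj (Units.map φ.toMonoidHom T) fun k hk => ?_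
  obtain ⟨U, hU⟩ := h k hk
  refine ⟨Units.map φ.toMonoidHom U, ?_⟩
  have := congrArg φ hU
  simpa using this

/-- On a finite-dimensional space the exponent of nilpotency is at most the dimension. -/
theorem Module.End.pow_finrank_eq_zero_of_isNilpotent {K E : Type*} [Field K] [AddCommGroup E]
    [Module K E] [FiniteDimensional K E] {N : Module.End K E} (hN : IsNilpotent N) :
    N ^ Module.finrank K E = 0 := by
  have h := LinearMap.aeval_self_charpoly N
  rwa [hN.charpoly_eq_X_pow_finrank, map_pow, Polynomial.aeval_X] at h

/-- Commuting unipotent elements have unipotent product. -/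
theorem Commute.isNilpotent_mul_sub_one {R : Type*} [Ring R] {a b : R} (hab : Commute a b)
    (ha : IsNilpotent (a - 1)) (hb : IsNilpotent (b - 1)) : IsNilpotent (a * b - 1) := by
  have hb' : IsNilpotent (a * (b - 1)) :=
    (hab.sub_right (Commute.one_right a)).isNilpotent_mul_left hb
  have he : a * b - 1 = a * (b - 1) + (a - 1) := by noncomm_ring
  rw [he]
  refine Commute.isNilpotent_add ?_ hb' ha
  refine Commute.mul_left ?_ ?_
  · exact (Commute.refl a).sub_right (Commute.one_right a)
  · exact ((hab.symm.sub_left (Commute.one_left a))).sub_right (Commute.one_right _)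

/-! ### Functions with vanishing iterated differences -/

/-- The Newton polynomial of `g` at `0` with `M` terms and step `s`, as a polynomial in the number
of steps. -/
noncomputable def newtonPoly (M : ℕ) (s : ℝ) (g : ℝ → ℝ) : Polynomial ℝ :=
  ∑ k ∈ Finset.range M, Polynomial.C (((fwdDiff s)^[k] g 0) / k.factorial) * descPochhammer ℝ k

/-- Newton's forward difference formula, truncated at the order `M` where differences vanish. -/
theorem eval_newtonPoly_natCast {M : ℕ} {s : ℝ} {g : ℝ → ℝ} (h : (fwdDiff s)^[M] g = 0) (n : ℕ) :
    (newtonPoly M s g).eval (n : ℝ) = g (n * s) := by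
  have hM : ∀ k, M ≤ k → (fwdDiff s)^[k] g = 0 := by
    intro k hk
    obtain ⟨j, rfl⟩ := Nat.exists_eq_add_of_le' hk
    rw [Function.iterate_add_apply, h]
    exact Function.iterate_fixed (by ext; simp [fwdDiff]) j
  have hN := shift_eq_sum_fwdDiff_iter s g n 0
  rw [zero_add, nsmul_eq_mul] at hN
  rw [hN, newtonPoly, Polynomial.eval_finsetSum]
  have hterm : ∀ k,
      (Polynomial.C (((fwdDiff s)^[k] g 0) / k.factorial) * descPochhammer ℝ k).eval (n : ℝ) =
        n.choose k • (fwdDiff s)^[k] g 0 := by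
    intro k
    rw [Polynomial.eval_mul, Polynomial.eval_C, nsmul_eq_mul, Nat.cast_choose_eq_descPochhammer_div]
    ring
  simp only [hterm]
  -- both sums extend to a common range: the added terms vanish by `hM` or by `n.choose k = 0`
  have hsub₁ : Finset.range (n + 1) ⊆ Finset.range (M + (n + 1)) :=
    Finset.range_subset_range.2 (Nat.le_add_left _ _)
  have hsub₂ : Finset.range M ⊆ Finset.range (M + (n + 1)) :=
    Finset.range_subset_range.2 (Nat.le_add_right _ _)
  rw [Finset.sum_subset hsub₁, Finset.sum_subset hsub₂]
  · intro k _ hk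
    rw [hM k (by simpa using hk)]
    simp
  · intro k _ hk
    rw [Nat.choose_eq_zero_of_lt (by simpa using hk), zero_smul]

theorem Polynomial.eq_of_eval_natCast_eq {P Q : Polynomial ℝ}
    (h : ∀ n : ℕ, P.eval (n : ℝ) = Q.eval (n : ℝ)) : P = Q :=
  Polynomial.eq_of_infinite_eval_eq P Q <|
    (Set.infinite_range_of_injective (Nat.cast_injective (R := ℝ))).mono <| by
      rintro _ ⟨n, rfl⟩
      exact h n

/-- The Newton polynomials for the steps `1` and `1 / m` agree at natural numbers, hence are
equal after rescaling; so `g` is given by the first one at the nonnegative rationals. -/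
theorem eq_eval_newtonPoly_of_nonneg {M : ℕ} {g : ℝ → ℝ} (hg : Continuous g)
    (h : ∀ s : ℝ, (fwdDiff s)^[M] g = 0) {t : ℝ} (ht : 0 ≤ t) :
    g t = (newtonPoly M 1 g).eval t := by
  have hrat : ∀ a m : ℕ, 0 < m → g (a / m) = (newtonPoly M 1 g).eval (a / m : ℝ) := by
    intro a m hm
    have hm' : (m : ℝ) ≠ 0 := by positivity
    have he : (newtonPoly M (1 / m) g).comp (Polynomial.C (m : ℝ) * Polynomial.X)
        = newtonPoly M 1 g := by
      refine Polynomial.eq_of_eval_natCast_eq fun n => ?_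
      rw [eval_newtonPoly_natCast (h 1), Polynomial.eval_comp]
      have := eval_newtonPoly_natCast (h (1 / m)) (m * n)
      simp only [Polynomial.eval_mul, Polynomial.eval_C, Polynomial.eval_X]
      push_cast at this
      rw [this]
      congr 1
      field_simp
    rw [← he, Polynomial.eval_comp]
    have := eval_newtonPoly_natCast (h (1 / m)) a
    simp only [Polynomial.eval_mul, Polynomial.eval_C, Polynomial.eval_X]
    rw [mul_div_cancel₀ _ hm', this]
    congr 1
    ring
  -- rational approximations `⌊t m⌋ / m` of `t`
  have hlim : Filter.Tendsto (fun m : ℕ => ((⌊t * m⌋₊ : ℝ) / m)) Filter.atTop (nhds t) :=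
    (tendsto_nat_floor_mul_div_atTop ht).comp tendsto_natCast_atTop_atTop
  refine tendsto_nhds_unique ((hg.tendsto t).comp hlim) ?_
  refine (((newtonPoly M 1 g).continuous.tendsto t).comp hlim).congr' ?_
  filter_upwards [Filter.eventually_gt_atTop 0] with m hm
  exact (hrat _ m hm).symm

/-- A continuous function on the line annihilated by the `M`-th differences of all steps is its
own Newton polynomial. -/
theorem eq_eval_newtonPoly {M : ℕ} {g : ℝ → ℝ} (hg : Continuous g)
    (h : ∀ s : ℝ, (fwdDiff s)^[M] g = 0) (t : ℝ) :
    g t = (newtonPoly M 1 g).eval t := by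
  obtain ⟨K, hK⟩ := exists_nat_ge (-t)
  -- move the base point to `-K`, to the left of `t`
  let g' : ℝ → ℝ := fun x => g (x + -(K : ℝ))
  have hg' : Continuous g' := by fun_prop
  have h' : ∀ s : ℝ, (fwdDiff s)^[M] g' = 0 := fun s => by
    ext y
    rw [fwdDiff_iter_comp_add, h s]
    rfl
  have he : (newtonPoly M 1 g').comp (Polynomial.X + Polynomial.C (K : ℝ)) = newtonPoly M 1 g := by
    refine Polynomial.eq_of_eval_natCast_eq fun n => ?_
    rw [Polynomial.eval_comp, ← eq_eval_newtonPoly_of_nonneg hg h n.cast_nonneg,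
      ← eq_eval_newtonPoly_of_nonneg hg' h' (by simp; positivity)]
    simp [g']
  rw [← he, Polynomial.eval_comp, ← eq_eval_newtonPoly_of_nonneg hg' h' (by simp; linarith)]
  simp [g']

/-! ### Translation invariant spaces -/

section Translation

variable {ι : Type*} {V : Submodule ℝ C(ι → ℝ, ℝ)}

/-- The translation `g ↦ g (· + h)` as an endomorphism of a translation invariant space. -/
def translateEnd (hV : IsTranslationInvariant V) (h : ι → ℝ) : Module.End ℝ V where
  toFun g := ⟨translateOp h g, hV h g g.2⟩
  map_add' _ _ := rfl
  map_smul' _ _ := rfl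

@[simp]
theorem translateEnd_apply_apply (hV : IsTranslationInvariant V) (h : ι → ℝ) (g : V) (x : ι → ℝ) :
    (translateEnd hV h g : C(ι → ℝ, ℝ)) x = (g : C(ι → ℝ, ℝ)) (x + h) :=
  rfl

theorem translateEnd_zero (hV : IsTranslationInvariant V) : translateEnd hV 0 = 1 := by
  ext g x
  simp

theorem translateEnd_add (hV : IsTranslationInvariant V) (h k : ι → ℝ) :
    translateEnd hV (h + k) = translateEnd hV h * translateEnd hV k := by
  ext g x
  simp [add_assoc]

theorem translateEnd_commute (hV : IsTranslationInvariant V) (h k : ι → ℝ) :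
    Commute (translateEnd hV h) (translateEnd hV k) := by
  rw [commute_iff_eq, ← translateEnd_add, ← translateEnd_add, add_comm]

theorem translateEnd_natCast_smul (hV : IsTranslationInvariant V) (n : ℕ) (h : ι → ℝ) :
    translateEnd hV ((n : ℝ) • h) = translateEnd hV h ^ n := by
  induction n with
  | zero => simp [translateEnd_zero]
  | succ n ih => rw [Nat.cast_succ, add_smul, one_smul, translateEnd_add, ih, pow_succ]

/-- Translations are invertible, the inverse being the opposite translation. -/
def translateUnit (hV : IsTranslationInvariant V) (h : ι → ℝ) : (Module.End ℝ V)ˣ where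
  val := translateEnd hV h
  inv := translateEnd hV (-h)
  val_inv := by rw [← translateEnd_add, add_neg_cancel, translateEnd_zero]
  inv_val := by rw [← translateEnd_add, neg_add_cancel, translateEnd_zero]

/-- Iterated differences of `g` along the line `x + ℝ u` are values of powers of `τ_{su} - 1`. -/
theorem translateEnd_sub_one_pow_apply (hV : IsTranslationInvariant V) (u : ι → ℝ) (s : ℝ) (k : ℕ)
    (g : V) (x : ι → ℝ) (t : ℝ) :
    (fwdDiff s)^[k] (fun r : ℝ => (g : C(ι → ℝ, ℝ)) (x + r • u)) t =
      (((translateEnd hV (s • u) - 1) ^ k) g : C(ι → ℝ, ℝ)) (x + t • u) := by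
  induction k generalizing t with
  | zero => simp
  | succ k ih =>
    rw [Function.iterate_succ_apply', fwdDiff, ih, ih, pow_succ']
    simp [add_smul, add_assoc]

/-- If all translations along the line `ℝ u` are unipotent on `V`, then along this line the
functions in `V` are polynomials whose coefficients again belong to `V`. -/
theorem exists_apply_add_smul_eq_sum [FiniteDimensional ℝ V] (hV : IsTranslationInvariant V)
    {u : ι → ℝ} (hu : ∀ s : ℝ, IsNilpotent (translateEnd hV (s • u) - 1)) (g : V) :
    ∃ (M : ℕ) (P : ℕ → Polynomial ℝ) (c : ℕ → V), ∀ (x : ι → ℝ) (t : ℝ),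
      (g : C(ι → ℝ, ℝ)) (x + t • u) =
        ∑ k ∈ Finset.range M, (P k).eval t * (c k : C(ι → ℝ, ℝ)) x := by
  refine ⟨Module.finrank ℝ V, fun k => Polynomial.C (1 / (k.factorial : ℝ)) * descPochhammer ℝ k,
    fun k => ((translateEnd hV u - 1) ^ k) g, fun x t => ?_⟩
  have h := eq_eval_newtonPoly (M := Module.finrank ℝ V)
    (g := fun r : ℝ => (g : C(ι → ℝ, ℝ)) (x + r • u)) (by fun_prop) (fun s => by
      ext r
      rw [translateEnd_sub_one_pow_apply hV,
        Module.End.pow_finrank_eq_zero_of_isNilpotent (hu s)]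
      rfl) t
  rw [h, newtonPoly, Polynomial.eval_finsetSum]
  refine Finset.sum_congr rfl fun k _ => ?_
  rw [translateEnd_sub_one_pow_apply hV]
  simp only [one_smul, zero_smul, add_zero, Polynomial.eval_mul, Polynomial.eval_C]
  ring

/-- If the translations along all coordinate axes are unipotent on `V`, then `V` consists of
polynomials. -/
theorem isOrdinaryPolynomial_of_isNilpotent [Fintype ι] [DecidableEq ι] [FiniteDimensional ℝ V]
    (hV : IsTranslationInvariant V)
    (hu : ∀ (i : ι) (s : ℝ), IsNilpotent (translateEnd hV (s • Pi.single i (1 : ℝ)) - 1))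
    {f : C(ι → ℝ, ℝ)} (hf : f ∈ V) : IsOrdinaryPolynomial f := by
  have key : ∀ (S : Finset ι) (g : V), ∃ F : MvPolynomial ι ℝ, ∀ x : ι → ℝ,
      (g : C(ι → ℝ, ℝ)) (∑ i ∈ S, x i • Pi.single i (1 : ℝ)) = MvPolynomial.eval x F := by
    intro S
    induction S using Finset.induction_on with
    | empty => exact fun g => ⟨MvPolynomial.C ((g : C(ι → ℝ, ℝ)) 0), fun x => by simp⟩
    | insert j S hj ih =>
      intro g
      obtain ⟨M, P, c, hc⟩ := exists_apply_add_smul_eq_sum hV (hu j) g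
      choose F hF using fun k => ih (c k)
      refine ⟨∑ k ∈ Finset.range M, (P k).toMvPolynomial j * F k, fun x => ?_⟩
      rw [Finset.sum_insert hj, add_comm, hc]
      simp [hF, MvPolynomial.eval_toMvPolynomial]
  obtain ⟨F, hF⟩ := key Finset.univ ⟨f, hf⟩
  refine ⟨F, fun x => ?_⟩
  rw [← hF, ← pi_eq_sum_univ' x]

end Translation

/-! ### Invariance under linear maps -/

/-- The action `g ↦ g (P ·)` of `P ∈ G` as an automorphism of a `G`-invariant space. -/
def linearUnit {ι : Type*} [Fintype ι] [DecidableEq ι] {G : Subgroup (GL ι ℝ)}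
    {V : Submodule ℝ C(ι → ℝ, ℝ)} (hG : IsInvariantBy G V) {P : GL ι ℝ} (hP : P ∈ G) :
    (Module.End ℝ V)ˣ where
  val :=
    { toFun g := ⟨linearOp P g, hG P hP g g.2⟩
      map_add' _ _ := rfl
      map_smul' _ _ := rfl }
  inv :=
    { toFun g := ⟨linearOp P⁻¹ g, hG P⁻¹ (inv_mem hP) g g.2⟩
      map_add' _ _ := rfl
      map_smul' _ _ := rfl }
  val_inv := by
    ext g x
    change (g : C(ι → ℝ, ℝ)) (((P⁻¹ : GL ι ℝ) : Matrix ι ι ℝ) *ᵥ ((P : Matrix ι ι ℝ) *ᵥ x)) = _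
    rw [Matrix.mulVec_mulVec, ← Units.val_mul, inv_mul_cancel, Units.val_one, Matrix.one_mulVec]
    rfl
  inv_val := by
    ext g x
    change (g : C(ι → ℝ, ℝ)) ((P : Matrix ι ι ℝ) *ᵥ (((P⁻¹ : GL ι ℝ) : Matrix ι ι ℝ) *ᵥ x)) = _
    rw [Matrix.mulVec_mulVec, ← Units.val_mul, mul_inv_cancel, Units.val_one, Matrix.one_mulVec]
    rfl

/-- If `G` contains elements scaling `u` by every positive integer, then translation by `u` is
unipotent, being conjugate to its powers. -/
theorem isNilpotent_translateEnd_sub_one {ι : Type*} [Fintype ι] [DecidableEq ι]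
    {G : Subgroup (GL ι ℝ)} {V : Submodule ℝ C(ι → ℝ, ℝ)} [FiniteDimensional ℝ V]
    (hV : IsTranslationInvariant V) (hG : IsInvariantBy G V) {u : ι → ℝ}
    (hu : ∀ n : ℕ, 1 ≤ n → ∃ P ∈ G, (P : Matrix ι ι ℝ) *ᵥ u = (n : ℝ) • u) :
    IsNilpotent (translateEnd hV u - 1) := by
  refine Module.End.isNilpotent_sub_one_of_pow_conj (translateUnit hV u) fun n hn => ?_
  obtain ⟨P, hP, hPu⟩ := hu n hn
  refine ⟨(linearUnit hG hP)⁻¹, ?_⟩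
  rw [inv_inv, mul_assoc, Units.eq_inv_mul_iff_mul_eq]
  change _ * translateEnd hV u ^ n = translateEnd hV u * _
  rw [← translateEnd_natCast_smul, ← hPu]
  ext g x
  change (g : C(ι → ℝ, ℝ)) ((P : Matrix ι ι ℝ) *ᵥ x + (P : Matrix ι ι ℝ) *ᵥ u) =
    (g : C(ι → ℝ, ℝ)) ((P : Matrix ι ι ℝ) *ᵥ (x + u))
  rw [Matrix.mulVec_add]

/-! ### Hyperbolic rotations -/

/-- A matrix preserving the form of signature `(p, q)` is automatically invertible. -/
theorem exists_mem_indefiniteOrthogonalGroup {p q : ℕ}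
    {B : Matrix (Fin p ⊕ Fin q) (Fin p ⊕ Fin q) ℝ}
    (hB : Bᵀ * signatureMatrix p q * B = signatureMatrix p q) :
    ∃ P ∈ indefiniteOrthogonalGroup p q, (P : Matrix (Fin p ⊕ Fin q) (Fin p ⊕ Fin q) ℝ) = B := by
  have hJ : signatureMatrix p q * signatureMatrix p q = 1 := by
    simp [signatureMatrix, Matrix.fromBlocks_multiply]
  have hinv : signatureMatrix p q * Bᵀ * signatureMatrix p q * B = 1 := by
    rw [Matrix.mul_assoc, Matrix.mul_assoc, ← Matrix.mul_assoc Bᵀ, hB, hJ]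
  exact ⟨⟨B, _, mul_eq_one_comm.1 hinv, hinv⟩, hB, rfl⟩

/-- The hyperbolic rotation with `cosh = (a + a⁻¹) / 2` and `sinh = ε (a - a⁻¹) / 2` in the plane
spanned by `e_i` and `e_j` scales the multiples of the null vector
`e_i + ε e_j`, `ε = ±1`, by `a`. -/
theorem exists_mulVec_null_eq_smul {p q : ℕ} (i : Fin p) (j : Fin q) {ε : ℝ} (hε : ε * ε = 1)
    {a : ℝ} (ha : a ≠ 0) :
    ∃ P ∈ indefiniteOrthogonalGroup p q, ∀ r : ℝ,
      (P : Matrix (Fin p ⊕ Fin q) (Fin p ⊕ Fin q) ℝ) *ᵥ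
        (r • (Pi.single (Sum.inl i) 1 + ε • Pi.single (Sum.inr j) 1)) =
      a • r • (Pi.single (Sum.inl i) 1 + ε • Pi.single (Sum.inr j) 1) := by
  -- `1 + c` is the hyperbolic cosine, and `hcs` is the identity `cosh² - sinh² = 1`
  obtain ⟨c, hc⟩ : ∃ c : ℝ, c = (a + a⁻¹) / 2 - 1 := ⟨_, rfl⟩
  obtain ⟨s, hs⟩ : ∃ s : ℝ, s = ε * ((a - a⁻¹) / 2) := ⟨_, rfl⟩
  have hcs : c + c + c * c = s * s := by
    have : s * s = (ε * ε) * ((a - a⁻¹) / 2 * ((a - a⁻¹) / 2)) := by rw [hs]; ring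
    rw [this, hε, hc]
    field_simp
    ring
  have hsum : 1 + c + s * ε = a := by
    have : s * ε = (ε * ε) * ((a - a⁻¹) / 2) := by rw [hs]; ring
    rw [this, hε, hc]
    ring
  have hsum' : s + (1 + c) * ε = a * ε := by
    linear_combination ε * hsum - s * hε
  let B : Matrix (Fin p ⊕ Fin q) (Fin p ⊕ Fin q) ℝ :=
    Matrix.fromBlocks (1 + Matrix.single i i c) (Matrix.single i j s) (Matrix.single j i s)
      (1 + Matrix.single j j c)
  have hB : Bᵀ * signatureMatrix p q * B = signatureMatrix p q := by
    simp only [B, signatureMatrix, Matrix.fromBlocks_transpose, Matrix.fromBlocks_multiply,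
      Matrix.transpose_add, Matrix.transpose_one, Matrix.transpose_single]
    simp only [Matrix.mul_zero, Matrix.mul_one, add_zero, zero_add, Matrix.mul_neg, Matrix.neg_mul,
      Matrix.add_mul, Matrix.mul_add, Matrix.one_mul, Matrix.single_mul_single_same]
    congr 1
    · rw [show c * c = s * s - c - c by linarith, ← sub_eq_zero]
      ext k l
      simp [Matrix.single_apply]
      split_ifs <;> ring
    · ext k l
      simp [Matrix.single_apply]
      split_ifs <;> ring
    · ext k l
      simp [Matrix.single_apply]
      split_ifs <;> ring
    · rw [show c * c = s * s - c - c by linarith, ← sub_eq_zero]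
      ext k l
      simp [Matrix.single_apply]
      split_ifs <;> ring
  obtain ⟨P, hP, hPB⟩ := exists_mem_indefiniteOrthogonalGroup hB
  refine ⟨P, hP, fun r => ?_⟩
  rw [hPB, Matrix.mulVec_smul, smul_comm a r]
  congr 1
  ext (k | k)
  · by_cases hk : k = i
    · subst hk
      simp [Matrix.mulVec_add, Matrix.mulVec_smul, B, ← hsum]
      ring
    · simp [Matrix.mulVec_add, Matrix.mulVec_smul, B, hk, Ne.symm hk]
  · by_cases hk : k = j
    · subst hk
      simp [Matrix.mulVec_add, Matrix.mulVec_smul, B, ← hsum']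
      ring
    · simp [Matrix.mulVec_add, Matrix.mulVec_smul, B, hk, Ne.symm hk]

theorem theorem3p2 (p q : ℕ) (hp : 1 ≤ p) (hq : 1 ≤ q)
    (V : Submodule ℝ C(Fin p ⊕ Fin q → ℝ, ℝ)) (hfin : FiniteDimensional ℝ V)
    (htrans : IsTranslationInvariant V)
    (hinv : IsInvariantBy (indefiniteOrthogonalGroup p q) V)
    (f : C(Fin p ⊕ Fin q → ℝ, ℝ)) (hf : f ∈ V) :
    IsOrdinaryPolynomial f := by
  have hnull : ∀ (i : Fin p) (j : Fin q) (ε : ℝ), ε * ε = 1 → ∀ r : ℝ, IsNilpotent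
      (translateEnd htrans (r • (Pi.single (Sum.inl i) 1 + ε • Pi.single (Sum.inr j) 1)) - 1) := by
    intro i j ε hε r
    refine isNilpotent_translateEnd_sub_one htrans hinv fun n hn => ?_
    obtain ⟨P, hP, h⟩ := exists_mulVec_null_eq_smul i j hε
      (Nat.cast_ne_zero.2 (Nat.one_le_iff_ne_zero.1 hn) : (n : ℝ) ≠ 0)
    exact ⟨P, hP, h r⟩
  -- `2 e_i = (e_i + e_j) + (e_i - e_j)` and `2 e_j = (e_i + e_j) - (e_i - e_j)`
  have hpair : ∀ (i : Fin p) (j : Fin q) (r t : ℝ), IsNilpotent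
      (translateEnd htrans (r • (Pi.single (Sum.inl i) 1 + (1 : ℝ) • Pi.single (Sum.inr j) 1) +
        t • (Pi.single (Sum.inl i) 1 + (-1 : ℝ) • Pi.single (Sum.inr j) 1)) - 1) := by
    intro i j r t
    rw [translateEnd_add]
    refine Commute.isNilpotent_mul_sub_one (R := Module.End ℝ V)
      (translateEnd_commute htrans _ _) ?_ ?_
    · exact hnull i j 1 (by norm_num) r
    · exact hnull i j (-1) (by norm_num) t
  refine isOrdinaryPolynomial_of_isNilpotent htrans ?_ hf
  rintro (i | j) s
  · convert hpair i ⟨0, hq⟩ (s / 2) (s / 2) using 3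
    module
  · convert hpair ⟨0, hp⟩ j (s / 2) (-(s / 2)) using 3
    module
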